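/- Let $V=(V,Y,\mathbf 1,\omega)$ be a vertex operator superalgebra over $\mathbb C$, graded by weights $V=\bigoplus_{n\in\frac12\mathbb Z_{\ge0}}V_n$ with $\dim V_n<\infty$, even part $V_{\bar0}=\bigoplus_{n\in\mathbb Z}V_n$ and odd part $V_{\bar1}=\bigoplus_{n\in\frac12+\mathbb Z}V_n$; write $Y(v,z)=\sum_{n\in\mathbb Z}v_nz^{-n-1}$. Let $\sigma$ be the automorphism of $V$ equal to $1$ on $V_{\bar0}$ and $-1$ on $V_{\bar1}$, let $g$ be an automorphism of $V$ (a linear automorphism with $g\omega=\omega$ and $gY(v,z)g^{-1}=Y(gv,z)$) of finite order $T_0$, let $T$ be the order of $g\sigma$, and put $$V^{r}=\{v\in V: gv=e^{2\pi ir/T_0}v\},\qquad V^{r*}=\{v\in V: g\sigma v=e^{2\pi ir/T}v\}.$$ *The algebra $A_g(V)$.* For $0\le r<T$, homogeneous $u\in V^{r*}$ and $v\in V$ put $\delta_r=1$ if $r=0$, $\delta_r=0$ if $r\neq0$, and $$u\circ_g v=\operatorname{Res}_z\frac{(1+z)^{\mathrm{wt}\,u-1+\delta_r+r/T}}{z^{1+\delta_r}}Y(u,z)v,\qquad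 u*_gv=\begin{cases}\operatorname{Res}_z\dfrac{(1+z)^{\mathrm{wt}\,u}}{z}Y(u,z)v,& r=0,\\ 0,& r\ne0,\end{cases}$$ and extend $*_g$ bilinearly to $V$. Let $O_g(V)$ be the linear span of all $u\circ_gv$. Then $A_g(V)=V/O_g(V)$ is the associative algebra with the product induced by $*_g$ and unit $\mathbf 1+O_g(V)$. *Twisted modules.* A weak $g$-twisted $V$-module is a complex vector space $M$ with a linear map $v\mapsto Y_M(v,z)=\sum_{n\in\frac1{T_0}\mathbb Z}v_nz^{-n-1}$, $v_n\in\operatorname{End}M$, such that for all $0\le r<T_0$, $u\in V^r$, $v\in V$, $w\in M$: $u_n=0$ unless $n\in\frac r{T_0}+\mathbb Z$; $u_nw=0$ for $n$ sufficiently large; $Y_M(\mathbf 1,z)=\mathrm{id}_M$; and, for $u,v$ homogeneous of parities $\tilde u,\tilde v$, $$z_0^{-1}\delta\Big(\frac{z_1-z_2}{z_0}\Big)Y_M(u,z_1)Y_M(v,z_2)-(-1)^{\tilde u\tilde v}z_0^{-1}\delta\Big(\frac{z_2-z_1}{-z_0}\Big)Y_M(v,z_2)Y_M(u,z_1)$$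 $$=z_2^{-1}\Big(\frac{z_1-z_0}{z_2}\Big)^{-r/T_0}\delta\Big(\frac{z_1-z_0}{z_2}\Big)Y_M(Y(u,z_0)v,z_2).$$ It is admissible if it carries a grading $M=\bigoplus_{n\in\frac1T\mathbb Z_{\ge0}}M(n)$ with $v_mM(n)\subseteq M(n+\mathrm{wt}\,v-m-1)$ for homogeneous $v\in V$. An admissible $M$ is simple if $M\ne0$ and $0$ and $M$ are its only graded submodules. The space of lowest weight vectors of $M$ is $$\Omega(M)=\{w\in M: u_{\mathrm{wt}\,u-1+n}\,w=0\ \text{ for all homogeneous }u\in V\text{ and all rational } n>0\}.$$ **Proposition.** Let $M$ be a simple admissible $g$-twisted $V$-module, graded so that $M(0)\neq0$. Then (i) $\Omega(M)=M(0)$; (ii) $\Omega(M)$ is a simple $A_g(V)$-module, where the class of a homogeneous $a\in V^{0*}$ acts by $o(a)=a_{\mathrm{wt}\,a-1}$. (That is, these operators preserve $\Omega(M)$ and give a well-defined unital $A_g(V)$-module structure on it, and $\Omega(M)$ is nonzero with no submodules other than $0$ and itself.) -/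

import Mathlib

open scoped DirectSum

noncomputable section

namespace VOSA

/-- The generalized binomial coefficient `x (x - 1) ⋯ (x - i + 1) / i!`, as a complex number. -/
def gbinom (x : ℚ) (i : ℕ) : ℂ := Ring.choose (x : ℂ) i

open scoped Classical in
/-- The parity of a weight: `0` for integral weights, `1` for the others (the weights of a vertex
operator superalgebra lie in `½ℤ₊`). -/
def parity (p : ℚ) : ℕ := if ∃ k : ℤ, p = k then 0 else 1

/-- A vertex operator superalgebra `(V, Y, 𝟏, ω)` over `ℂ`.

* `gr n` is the homogeneous subspace `V_n`. It is indexed by `n : ℚ`, but it vanishes unless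
  `n ∈ ½ℤ₊`. The even (odd) part of `V` is the sum of the `V_n` with `n` integral
  (half-integral), so a vector in `V_p` has parity `parity p`.
* `Y v n` is the mode `v_n` in `Y(v, z) = ∑_{n ∈ ℤ} v_n z^{-n-1}`.
* `jacobi` is the equality of the coefficients of `z₀^{-l-1} z₁^{-m-1} z₂^{-n-1}` on the two sides
  of the Jacobi identity
  `z₀⁻¹ δ((z₁-z₂)/z₀) Y(u,z₁) Y(v,z₂) - (-1)^{ũṽ} z₀⁻¹ δ((z₂-z₁)/(-z₀)) Y(v,z₂) Y(u,z₁)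
    = z₂⁻¹ δ((z₁-z₀)/z₂) Y(Y(u,z₀)v, z₂)`,
  applied to a vector `w`. All the sums in it are finite, by `truncation`. -/
structure VertexOperatorSuperalgebra (V : Type*) [AddCommGroup V] [Module ℂ V] where
  gr : ℚ → Submodule ℂ V
  gr_eq_bot : ∀ n : ℚ, (¬ ∃ k : ℕ, n = (k : ℚ) / 2) → gr n = ⊥
  isInternal : DirectSum.IsInternal gr
  finite_gr : ∀ n : ℚ, FiniteDimensional ℂ (gr n)
  Y : V →ₗ[ℂ] (ℤ → Module.End ℂ V)
  one : V
  omega : V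
  c : ℂ
  one_mem : one ∈ gr 0
  omega_mem : omega ∈ gr 2
  truncation : ∀ u v : V, ∃ N : ℤ, ∀ n : ℤ, N ≤ n → Y u n v = 0
  vacuum : ∀ n : ℤ, Y one n = if n = -1 then 1 else 0
  creation_nonneg : ∀ (v : V) (n : ℤ), 0 ≤ n → Y v n one = 0
  creation : ∀ v : V, Y v (-1) one = v
  virasoro : ∀ m n : ℤ,
    Y omega (m + 1) * Y omega (n + 1) - Y omega (n + 1) * Y omega (m + 1) =
      ((m : ℂ) - n) • Y omega (m + n + 1) +
        (if m + n = 0 then (1 / 12 : ℂ) * ((m : ℂ) ^ 3 - m) * c else 0) • (1 : Module.End ℂ V)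
  derivative : ∀ (v : V) (n : ℤ), Y (Y omega 0 v) n = (-(n : ℂ)) • Y v (n - 1)
  weight : ∀ (n : ℚ) (v : V), v ∈ gr n → Y omega 1 v = (n : ℂ) • v
  jacobi : ∀ (p q : ℚ) (u v w : V), u ∈ gr p → v ∈ gr q → ∀ l m n : ℤ,
    (∑ᶠ i : ℕ, ((-1) ^ i * gbinom l i) • Y u (l + m - i) (Y v (n + i) w)) -
        ((-1) ^ (parity p * parity q) * (-1) ^ l : ℂ) •
          (∑ᶠ i : ℕ, ((-1) ^ i * gbinom l i) • Y v (l + n - i) (Y u (m + i) w)) =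
      ∑ᶠ i : ℕ, gbinom m i • Y (Y u (l + i) v) (m + n - i) w

/-- `T₀`, the order of `g`. -/
def ordG {V : Type*} [AddCommGroup V] [Module ℂ V] (g : V ≃ₗ[ℂ] V) : ℕ := orderOf g

/-- `V^r = {v | g v = e^{2πir/T₀} v}`. -/
def eigG {V : Type*} [AddCommGroup V] [Module ℂ V] (g : V ≃ₗ[ℂ] V) (r : ℕ) :
    Submodule ℂ V :=
  Module.End.eigenspace g.toLinearMap
    (Complex.exp (2 * Real.pi * Complex.I * r / (ordG g : ℂ)))

namespace VertexOperatorSuperalgebra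

variable {V : Type*} [AddCommGroup V] [Module ℂ V] (S : VertexOperatorSuperalgebra V)

/-- The decomposition of a vector into its homogeneous components. -/
def components : V ≃ₗ[ℂ] (⨁ n : ℚ, S.gr n) :=
  (LinearEquiv.ofBijective (DirectSum.coeLinearMap S.gr)
    (show Function.Bijective (DirectSum.coeLinearMap S.gr) from S.isInternal)).symm

theorem components_of_mem {p : ℚ} {v : V} (hv : v ∈ S.gr p) :
    S.components v = DirectSum.lof ℂ ℚ (fun n => S.gr n) p ⟨v, hv⟩ := by
  rw [components, LinearEquiv.symm_apply_eq]
  simp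

/-- The canonical automorphism `σ`: `1` on the even part, `-1` on the odd part. -/
def sigma : Module.End ℂ V :=
  (DirectSum.toModule ℂ ℚ V fun n => ((-1 : ℂ) ^ parity n) • (S.gr n).subtype) ∘ₗ
    S.components.toLinearMap

theorem sigma_of_mem {p : ℚ} {v : V} (hv : v ∈ S.gr p) :
    S.sigma v = ((-1 : ℂ) ^ parity p) • v := by
  simp [sigma, S.components_of_mem hv]

/-- `g` is an automorphism of the vertex operator superalgebra. -/
structure IsAutomorphism (g : V ≃ₗ[ℂ] V) : Prop where
  map_omega : g S.omega = S.omega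
  map_Y : ∀ (u v : V) (n : ℤ), g (S.Y u n v) = S.Y (g u) n (g v)

/-- The composite `gσ`. -/
def gSigma (g : V ≃ₗ[ℂ] V) : Module.End ℂ V := g.toLinearMap * S.sigma

/-- `T`, the order of `gσ`. -/
def ordGS (g : V ≃ₗ[ℂ] V) : ℕ := orderOf (S.gSigma g)

/-- `V^{r*} = {v | gσ v = e^{2πir/T} v}`. -/
def eigGS (g : V ≃ₗ[ℂ] V) (r : ℕ) : Submodule ℂ V :=
  Module.End.eigenspace (S.gSigma g)
    (Complex.exp (2 * Real.pi * Complex.I * r / (S.ordGS g : ℂ)))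

theorem finite_support_res (a : ℚ) (k : ℤ) (u v : V) :
    (Function.support fun i : ℕ => gbinom a i • S.Y u (k + i) v).Finite := by
  obtain ⟨N, hN⟩ := S.truncation u v
  refine (Set.finite_lt_nat (N - k).toNat).subset fun i hi => ?_
  by_contra h
  refine hi ?_
  have : N ≤ k + i := by
    simp only [Set.mem_ofPred_eq, not_lt] at h
    omega
  simp [hN _ this]

/-- `Res_z (1 + z)^a z^k Y(u, z) v = ∑_{i ≥ 0} (a choose i) u_{k+i} v`, bilinear in `u` and `v`. -/
def res (a : ℚ) (k : ℤ) : V →ₗ[ℂ] V →ₗ[ℂ] V :=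
  LinearMap.mk₂ ℂ (fun u v => ∑ᶠ i : ℕ, gbinom a i • S.Y u (k + i) v)
    (fun u u' v => by
      rw [← finsum_add_distrib (S.finite_support_res a k u v) (S.finite_support_res a k u' v)]
      simp)
    (fun r u v => by
      rw [smul_finsum' r (S.finite_support_res a k u v)]
      simp [smul_comm r])
    (fun u v v' => by
      rw [← finsum_add_distrib (S.finite_support_res a k u v) (S.finite_support_res a k u v')]
      simp)
    (fun r u v => by
      rw [smul_finsum' r (S.finite_support_res a k u v)]
      simp [smul_comm r])

/-- For `u ∈ V^{r*}` of weight `p` (with `0 ≤ r < T`), the vector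
`u ∘_g v = Res_z (1 + z)^{p - 1 + δ_r + r/T} z^{-1 - δ_r} Y(u, z) v`,
where `δ_r` is `1` for `r = 0` and `0` otherwise. -/
def circ (g : V ≃ₗ[ℂ] V) (p : ℚ) (r : ℕ) (u v : V) : V :=
  S.res (p - 1 + (if r = 0 then 1 else 0) + (r : ℚ) / (S.ordGS g : ℚ))
    (-1 - (if r = 0 then 1 else 0)) u v

/-- `O_g(V)`, the linear span of all `u ∘_g v`. -/
def Og (g : V ≃ₗ[ℂ] V) : Submodule ℂ V :=
  Submodule.span ℂ {x | ∃ (p : ℚ) (r : ℕ) (u v : V), r < S.ordGS g ∧ u ∈ S.gr p ∧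
    u ∈ S.eigGS g r ∧ x = S.circ g p r u v}

/-- The projection of `V = ⊕ V^{r*}` onto `V^{0*}`: the average over the powers of `gσ`. -/
def projFixed (g : V ≃ₗ[ℂ] V) : Module.End ℂ V :=
  ((S.ordGS g : ℂ)⁻¹) • ∑ j ∈ Finset.range (S.ordGS g), S.gSigma g ^ j

theorem gSigma_pow_of_mem (g : V ≃ₗ[ℂ] V) {r : ℕ} {u : V} (hu : u ∈ S.eigGS g r) (j : ℕ) :
    (S.gSigma g ^ j) u =
      (Complex.exp (2 * Real.pi * Complex.I * r / (S.ordGS g : ℂ))) ^ j • u := by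
  have h : S.gSigma g u = _ := Module.End.mem_eigenspace_iff.1 hu
  induction j with
  | zero => simp
  | succ j ih => rw [pow_succ, Module.End.mul_apply, h, map_smul, ih, smul_smul, pow_succ, mul_comm]

theorem projFixed_of_mem_zero (g : V ≃ₗ[ℂ] V) (hT : 0 < S.ordGS g) {u : V}
    (hu : u ∈ S.eigGS g 0) : S.projFixed g u = u := by
  have hT' : (S.ordGS g : ℂ) ≠ 0 := by exact_mod_cast hT.ne'
  simp only [projFixed, LinearMap.smul_apply, LinearMap.sum_apply, S.gSigma_pow_of_mem g hu]
  rw [← Finset.sum_smul, smul_smul]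
  simp [hT']

theorem projFixed_of_mem_pos (g : V ≃ₗ[ℂ] V) {r : ℕ} (hr : 0 < r) (hrT : r < S.ordGS g) {u : V}
    (hu : u ∈ S.eigGS g r) : S.projFixed g u = 0 := by
  have hT : S.ordGS g ≠ 0 := by omega
  have hprim := (Complex.isPrimitiveRoot_exp (S.ordGS g) hT)
  have hexp : Complex.exp (2 * Real.pi * Complex.I * r / (S.ordGS g : ℂ)) =
      Complex.exp (2 * Real.pi * Complex.I / (S.ordGS g : ℂ)) ^ r := by
    rw [← Complex.exp_nat_mul]
    congr 1
    ring
  have hne := hprim.pow_ne_one_of_pos_of_lt hr.ne' hrT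
  have hsum : ∑ j ∈ Finset.range (S.ordGS g),
      (Complex.exp (2 * Real.pi * Complex.I / (S.ordGS g : ℂ)) ^ r) ^ j = 0 := by
    have h := mul_geom_sum (Complex.exp (2 * Real.pi * Complex.I / (S.ordGS g : ℂ)) ^ r)
      (S.ordGS g)
    rw [← pow_mul, mul_comm r, pow_mul, hprim.pow_eq_one, one_pow, sub_self] at h
    exact (mul_eq_zero.1 h).resolve_left (sub_ne_zero.2 hne)
  simp only [projFixed, LinearMap.smul_apply, LinearMap.sum_apply, S.gSigma_pow_of_mem g hu]
  rw [← Finset.sum_smul, hexp, hsum]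
  simp

/-- The bilinear product `*_g` on `V`. For homogeneous `u` it is
`u *_g v = Res_z (1 + z)^{wt u} z⁻¹ Y(u, z) v` if `u ∈ V^{0*}`, and `0` if `u ∈ V^{r*}` with
`0 < r < T`; see `star_of_mem_zero` and `star_of_mem_pos`. -/
def star (g : V ≃ₗ[ℂ] V) : V →ₗ[ℂ] V →ₗ[ℂ] V :=
  (DirectSum.toModule ℂ ℚ (V →ₗ[ℂ] V) fun p => S.res p (-1) ∘ₗ (S.gr p).subtype) ∘ₗ
    S.components.toLinearMap ∘ₗ S.projFixed g

theorem star_of_mem_zero (g : V ≃ₗ[ℂ] V) (hT : 0 < S.ordGS g) {p : ℚ} {u : V} (hp : u ∈ S.gr p)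
    (hu : u ∈ S.eigGS g 0) (v : V) : S.star g u v = S.res p (-1) u v := by
  simp [star, S.projFixed_of_mem_zero g hT hu, S.components_of_mem hp]

theorem star_of_mem_pos (g : V ≃ₗ[ℂ] V) {r : ℕ} (hr : 0 < r) (hrT : r < S.ordGS g) {u : V}
    (hu : u ∈ S.eigGS g r) (v : V) : S.star g u v = 0 := by
  simp [star, S.projFixed_of_mem_pos g hr hrT hu]

/-- `A_g(V) = V / O_g(V)`. Its product is induced by `*_g`, its unit is the class of `𝟏`. -/
abbrev Ag (g : V ≃ₗ[ℂ] V) : Type _ := V ⧸ S.Og g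

/-- A (unital, left) module structure over `A_g(V)` on the vector space `W`: a linear map
`A_g(V) → End W` that takes the product induced by `*_g` to composition, and the class of `𝟏` to
the identity. -/
structure AgModule (g : V ≃ₗ[ℂ] V) (W : Type*) [AddCommGroup W] [Module ℂ W] where
  act : S.Ag g →ₗ[ℂ] Module.End ℂ W
  act_star : ∀ a b : V, act ((S.Og g).mkQ (S.star g a b)) =
    act ((S.Og g).mkQ a) * act ((S.Og g).mkQ b)
  act_one : act ((S.Og g).mkQ S.one) = 1

/-- The module is simple: it is nonzero, and `0` and `W` are its only submodules. -/
def AgModule.IsSimple {S : VertexOperatorSuperalgebra V} {g : V ≃ₗ[ℂ] V} {W : Type*}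
    [AddCommGroup W] [Module ℂ W] (R : S.AgModule g W) : Prop :=
  Nontrivial W ∧ ∀ N : Submodule ℂ W, (∀ a : S.Ag g, ∀ w ∈ N, R.act a w ∈ N) → N = ⊥ ∨ N = ⊤

end VertexOperatorSuperalgebra

/-- A weak `g`-twisted `V`-module structure on the vector space `M`.

* `Y v n` is the mode `v_n` in `Y_M(v, z) = ∑ v_n z^{-n-1}`. It is indexed by `n : ℚ`, but for
  `u ∈ V^r` it vanishes unless `n ∈ r/T₀ + ℤ`; as `V` is the sum of the `V^r`, only the
  exponents in `(1/T₀)ℤ` occur.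
* `jacobi` is the equality of the coefficients of `z₀^{-l-1} z₁^{-m-1} z₂^{-n-1}`, where
  `m ∈ r/T₀ + ℤ`, on the two sides of the twisted Jacobi identity for `u ∈ V^r`,
  `z₀⁻¹ δ((z₁-z₂)/z₀) Y_M(u,z₁) Y_M(v,z₂) - (-1)^{ũṽ} z₀⁻¹ δ((z₂-z₁)/(-z₀)) Y_M(v,z₂) Y_M(u,z₁)
    = z₂⁻¹ ((z₁-z₀)/z₂)^{-r/T₀} δ((z₁-z₀)/z₂) Y_M(Y(u,z₀)v, z₂)`,
  applied to a vector `w`. The other coefficients vanish on both sides. All the sums are finite,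
  by the truncation properties. -/
structure WeakTwistedModule {V : Type*} [AddCommGroup V] [Module ℂ V]
    (S : VertexOperatorSuperalgebra V) (g : V ≃ₗ[ℂ] V)
    (M : Type*) [AddCommGroup M] [Module ℂ M] where
  Y : V →ₗ[ℂ] (ℚ → Module.End ℂ M)
  exponents : ∀ r : ℕ, r < ordG g → ∀ u ∈ eigG g r, ∀ n : ℚ,
    (¬ ∃ k : ℤ, n = (r : ℚ) / (ordG g : ℚ) + k) → Y u n = 0
  truncation : ∀ (u : V) (w : M), ∃ N : ℚ, ∀ n : ℚ, N ≤ n → Y u n w = 0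
  vacuum : ∀ n : ℚ, Y S.one n = if n = -1 then 1 else 0
  jacobi : ∀ r : ℕ, r < ordG g → ∀ (p q : ℚ) (u v : V) (w : M),
    u ∈ eigG g r → u ∈ S.gr p → v ∈ S.gr q →
    ∀ (l : ℤ) (m n : ℚ), (∃ k : ℤ, m = (r : ℚ) / (ordG g : ℚ) + k) →
    (∑ᶠ i : ℕ, ((-1) ^ i * gbinom l i) • Y u (l + m - i) (Y v (n + i) w)) -
        ((-1) ^ (parity p * parity q) * (-1) ^ l : ℂ) •
          (∑ᶠ i : ℕ, ((-1) ^ i * gbinom l i) • Y v (l + n - i) (Y u (m + i) w)) =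
      ∑ᶠ i : ℕ, gbinom m i • Y (S.Y u (l + i) v) (m + n - i) w

/-- The space of lowest weight vectors `Ω(M)`: the vectors killed by all modes
`u_{wt u - 1 + n}` with `u` homogeneous and `n > 0`, that is by all modes of negative degree
(the degree of `u_m` is `wt u - m - 1`). -/
def WeakTwistedModule.Omega {V : Type*} [AddCommGroup V] [Module ℂ V]
    {S : VertexOperatorSuperalgebra V} {g : V ≃ₗ[ℂ] V}
    {M : Type*} [AddCommGroup M] [Module ℂ M] (A : WeakTwistedModule S g M) : Submodule ℂ M where
  carrier := {w | ∀ (p : ℚ) (u : V), u ∈ S.gr p → ∀ n : ℚ, 0 < n → A.Y u (p - 1 + n) w = 0}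
  add_mem' ha hb p u hu n hn := by simp [ha p u hu n hn, hb p u hu n hn]
  zero_mem' p u hu n hn := by simp
  smul_mem' c x hx p u hu n hn := by simp [hx p u hu n hn]

/-- An admissible `g`-twisted `V`-module: a weak one with a grading `M = ⊕ M(n)` by
`n ∈ (1/T)ℤ₊` such that `v_m M(n) ⊆ M(n + wt v - m - 1)` for homogeneous `v`. Here `gr n` is
`M(n)`, indexed by `n : ℚ` and zero unless `n ∈ (1/T)ℤ₊`. -/
structure AdmissibleTwistedModule {V : Type*} [AddCommGroup V] [Module ℂ V]
    (S : VertexOperatorSuperalgebra V) (g : V ≃ₗ[ℂ] V)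
    (M : Type*) [AddCommGroup M] [Module ℂ M] extends WeakTwistedModule S g M where
  gr : ℚ → Submodule ℂ M
  gr_eq_bot : ∀ n : ℚ, (¬ ∃ k : ℕ, n = (k : ℚ) / (S.ordGS g : ℚ)) → gr n = ⊥
  isInternal : DirectSum.IsInternal gr
  map_gr : ∀ (p : ℚ) (v : V), v ∈ S.gr p → ∀ (m n : ℚ) (w : M), w ∈ gr n →
    Y v m w ∈ gr (n + p - m - 1)

/-- `M` is simple: it is nonzero, and `0` and `M` are its only graded submodules. -/
def AdmissibleTwistedModule.IsSimple {V : Type*} [AddCommGroup V] [Module ℂ V]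
    {S : VertexOperatorSuperalgebra V} {g : V ≃ₗ[ℂ] V}
    {M : Type*} [AddCommGroup M] [Module ℂ M] (A : AdmissibleTwistedModule S g M) : Prop :=
  Nontrivial M ∧ ∀ N : Submodule ℂ M, (∀ (v : V) (m : ℚ), ∀ w ∈ N, A.Y v m w ∈ N) →
    N = ⨆ n : ℚ, N ⊓ A.gr n → N = ⊥ ∨ N = ⊤

end VOSA

end

noncomputable section

namespace VOSA

/-! Everything rests on one fact: for any subspace `W`, the span of the vectors `v_m w` with `w ∈ W`
is already a submodule (`Y_mem_modeSpan_of_mem`), because the Jacobi identity rewrites `u_k v_n w`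
through single modes of iterates. In a simple `M`, a nonzero `W ⊆ M(d)` therefore has `M` as its
mode span. Comparing degrees, `M(0)` is spanned by the vectors `v_{d + wt v - 1} w`
(`gr_zero_le_of_modeSpan_eq_top`).

Both claims follow. If `d > 0` and `W = Ω(M) ∩ M(d)`, these modes have negative degree and kill `W`,
so `W ≠ 0` would force `M(0) = 0`; since `Ω(M)` is graded, it equals `M(0)`. If `d = 0` and `W` is a
nonzero `A_g(V)`-submodule of `M(0)`, these modes are zero modes and preserve `W`, so `W = M(0)`.

That zero modes give an `A_g(V)`-action is again the Jacobi identity, with exponents chosen so that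
lowest weight vectors kill all unwanted terms on the left (`zeroMode_circ`, `zeroMode_star`). -/

/-! ### Linear algebra and binomial coefficients. -/

theorem mem_of_mem_sup_iSup_ne {ι R M : Type*} [Ring R] [AddCommGroup M] [Module R M]
    {E : ι → Submodule R M} (hE : iSupIndep E) {i : ι} {N : Submodule R M} (hN : N ≤ E i) {x : M}
    (hx : x ∈ E i) (hx' : x ∈ N ⊔ ⨆ (j) (_ : j ≠ i), E j) : x ∈ N := by
  obtain ⟨a, ha, b, hb, rfl⟩ := Submodule.mem_sup.1 hx'
  have hb' : b ∈ E i := by simpa using (E i).sub_mem hx (hN ha)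
  have : b = 0 := by simpa using (Submodule.disjoint_def.1 (hE i)) b hb' hb
  simpa [this] using ha

theorem exp_mul_natCast_div (n r : ℕ) :
    Complex.exp (2 * Real.pi * Complex.I * r / (n : ℂ)) =
      Complex.exp (2 * Real.pi * Complex.I / (n : ℂ)) ^ r := by
  rw [← Complex.exp_nat_mul]
  congr 1
  ring

/-- A submodule stable under an operator of finite order is spanned by the eigenvectors
it contains. -/
theorem mem_span_eigenvectors {V : Type*} [AddCommGroup V] [Module ℂ V] {f : Module.End ℂ V}
    {n : ℕ} (hn : 0 < n) (hf : f ^ n = 1) {P : Submodule ℂ V} (hP : ∀ v ∈ P, f v ∈ P) {v : V}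
    (hv : v ∈ P) :
    v ∈ Submodule.span ℂ {x | x ∈ P ∧ ∃ r < n, x ∈ Module.End.eigenspace f
      (Complex.exp (2 * Real.pi * Complex.I * r / (n : ℂ)))} := by
  set ζ := Complex.exp (2 * Real.pi * Complex.I / (n : ℂ)) with hζ
  have hprim : IsPrimitiveRoot ζ n := Complex.isPrimitiveRoot_exp n hn.ne'
  have hpow : ∀ j, (f ^ j) v ∈ P := by
    intro j
    induction j with
    | zero => simpa
    | succ j ih => rw [pow_succ']; exact hP _ ih
  have hζ0 : ζ ≠ 0 := Complex.exp_ne_zero _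
  have hn0 : (n : ℂ) ≠ 0 := by exact_mod_cast hn.ne'
  -- Fourier inversion on the cyclic group: summing over `r` first kills every term with `j ≠ 0`.
  have key : v = (n : ℂ)⁻¹ • ∑ r ∈ Finset.range n, ∑ j ∈ Finset.range n,
      ((ζ ^ r)⁻¹ ^ j) • (f ^ j) v := by
    rw [Finset.sum_comm]
    simp only [← Finset.sum_smul]
    rw [Finset.sum_eq_single_of_mem 0 (Finset.mem_range.2 hn)]
    · simp [smul_smul, hn0]
    · intro j hj hj0
      have hne : ζ⁻¹ ^ j ≠ 1 :=
        hprim.inv.pow_ne_one_of_pos_of_lt hj0 (Finset.mem_range.1 hj)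
      have h1 : (ζ⁻¹ ^ j) ^ n = 1 := by
        rw [← pow_mul, mul_comm, pow_mul, hprim.inv.pow_eq_one, one_pow]
      have h2 := mul_geom_sum (ζ⁻¹ ^ j) n
      rw [h1, sub_self] at h2
      have h3 := (mul_eq_zero.1 h2).resolve_left (sub_ne_zero.2 hne)
      rw [show (∑ r ∈ Finset.range n, (ζ ^ r)⁻¹ ^ j) = 0 by
        rw [← h3]; refine Finset.sum_congr rfl fun r _ => ?_
        rw [← inv_pow, ← pow_mul, ← pow_mul, mul_comm], zero_smul]
  rw [key]
  refine Submodule.smul_mem _ _ (Submodule.sum_mem _ fun r hr => Submodule.subset_span ⟨?_, r,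
    Finset.mem_range.1 hr, ?_⟩)
  · exact Submodule.sum_mem _ fun j _ => Submodule.smul_mem _ _ (hpow j)
  · rw [Module.End.mem_eigenspace_iff, exp_mul_natCast_div, ← hζ, map_sum]
    have hz0 : ζ ^ r ≠ 0 := pow_ne_zero _ hζ0
    have hzn : (ζ ^ r)⁻¹ ^ n = 1 := by
      rw [inv_pow, ← pow_mul, mul_comm, pow_mul, hprim.pow_eq_one, one_pow, inv_one]
    -- The terms `j = 0` and `j = n` agree, so the sum is unchanged by the shift `j ↦ j + 1`;
    -- applying `f` then only multiplies it by `ζ ^ r`.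
    have h1 := Finset.sum_range_succ (fun j => ((ζ ^ r)⁻¹ ^ j) • (f ^ j) v) n
    rw [Finset.sum_range_succ', hzn, hf] at h1
    simp only [pow_zero] at h1
    rw [← add_right_cancel h1, Finset.smul_sum]
    refine Finset.sum_congr rfl fun j _ => ?_
    rw [map_smul, smul_smul, pow_succ (ζ ^ r)⁻¹, pow_succ' f, mul_comm, mul_assoc,
      inv_mul_cancel₀ hz0, mul_one, Module.End.mul_apply]

theorem gbinom_zero_right (x : ℚ) : gbinom x 0 = 1 := by simp [gbinom]

theorem gbinom_zero_left {i : ℕ} (hi : i ≠ 0) : gbinom 0 i = 0 := by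
  simp [gbinom, Ring.choose_zero_ite, hi]

theorem gbinom_one_one : gbinom 1 1 = 1 := by simp [gbinom]

theorem gbinom_one_left {i : ℕ} (hi : 2 ≤ i) : gbinom 1 i = 0 := by
  have h := Ring.choose_natCast (R := ℂ) 1 i
  rw [Nat.choose_eq_zero_of_lt (by omega)] at h
  simpa [gbinom] using h

/-! ### Weights, and the eigenspaces of `g` and `gσ`. -/

namespace VertexOperatorSuperalgebra

variable {V : Type*} [AddCommGroup V] [Module ℂ V] (S : VertexOperatorSuperalgebra V)

/-- An additive property holds for all vectors if it holds for homogeneous ones. -/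
@[elab_as_elim]
theorem gr_induction {P : V → Prop} (v : V) (hom : ∀ p, ∀ u ∈ S.gr p, P u) (zero : P 0)
    (add : ∀ u v, P u → P v → P (u + v)) : P v := by
  have hv : v ∈ ⨆ p, S.gr p := by rw [S.isInternal.submodule_iSup_eq_top]; trivial
  induction hv using Submodule.iSup_induction' with
  | mem p x hx => exact hom p x hx
  | zero => exact zero
  | add x y _ _ hx hy => exact add x y hx hy

/-- Eigenspaces of `L(0) = ω_1` are independent and the `V_q` exhaust `V`, so each `V_p` is a full
eigenspace. Weights can then be computed by applying `ω_1`. -/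
theorem mem_gr_iff {p : ℚ} {v : V} : v ∈ S.gr p ↔ S.Y S.omega 1 v = (p : ℂ) • v := by
  refine ⟨S.weight p v, fun h => ?_⟩
  have hle : ∀ q : ℚ, S.gr q ≤ Module.End.eigenspace (S.Y S.omega 1) (q : ℂ) := fun q x hx =>
    Module.End.mem_eigenspace_iff.2 (S.weight q x hx)
  have hind : iSupIndep fun q : ℚ => Module.End.eigenspace (S.Y S.omega 1) (q : ℂ) :=
    (Module.End.eigenspaces_iSupIndep (S.Y S.omega 1)).comp Rat.cast_injective
  refine mem_of_mem_sup_iSup_ne hind (hle p) (Module.End.mem_eigenspace_iff.2 h) ?_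
  have hv : v ∈ ⨆ q, S.gr q := by rw [S.isInternal.submodule_iSup_eq_top]; trivial
  refine (iSup_le fun q => ?_ : (⨆ q, S.gr q) ≤ _) hv
  by_cases hq : q = p
  · subst hq; exact le_sup_left
  · exact (hle q).trans (le_sup_of_le_right (le_iSup₂_of_le
      (f := fun (j : ℚ) (_ : j ≠ p) => Module.End.eigenspace (S.Y S.omega 1) (j : ℂ)) q hq le_rfl))

theorem parity_two : parity 2 = 0 := by
  rw [parity, if_pos ⟨2, by norm_num⟩]

/-- The mode `u_n` maps `V_q` to `V_{wt u + q - n - 1}`. -/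
theorem Y_mem_gr {p q : ℚ} {u v : V} (hu : u ∈ S.gr p) (hv : v ∈ S.gr q) (n : ℤ) :
    S.Y u n v ∈ S.gr (p + q - n - 1) := by
  rw [mem_gr_iff]
  -- With `l = 0`, `m = 1` this is `[ω_1, u_n] = (ω_0 u)_{n+1} + (ω_1 u)_n`, and `ω_0 u` is the
  -- derivative of `u`.
  have h := S.jacobi 2 p S.omega u v S.omega_mem hu 0 1 n
  rw [finsum_eq_single _ 0, finsum_eq_single _ 0, finsum_eq_sum_of_support_subset (s := {0, 1})] at h
  · simp [gbinom_zero_right, gbinom_one_one, parity_two, S.derivative, S.weight p u hu,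
      S.weight q v hv] at h
    rw [sub_eq_iff_eq_add] at h
    rw [h]
    push_cast
    module
  · intro i hi
    simp only [Finset.coe_insert, Finset.coe_singleton, Set.mem_insert_iff, Set.mem_singleton_iff]
    by_contra hc
    exact hi (by simp [gbinom_one_left (show 2 ≤ i by omega)])
  · intro i hi
    simp [gbinom_zero_left hi]
  · intro i hi
    simp [gbinom_zero_left hi]

variable {S} {g : V ≃ₗ[ℂ] V}

theorem IsAutomorphism.map_mem_gr (hg : S.IsAutomorphism g) {p : ℚ} {v : V} (hv : v ∈ S.gr p) :
    g v ∈ S.gr p := by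
  rw [mem_gr_iff]
  have h := hg.map_Y S.omega v 1
  rw [hg.map_omega, S.weight p v hv, map_smul] at h
  exact h.symm

theorem IsAutomorphism.map_one (hg : S.IsAutomorphism g) : g S.one = S.one := by
  -- Apply `g` to `𝟏_{-1} g⁻¹𝟏 = g⁻¹𝟏`; on the other side creation turns `(g𝟏)_{-1} 𝟏` into `g𝟏`.
  have h := hg.map_Y S.one (g.symm S.one) (-1)
  simpa [S.vacuum, S.creation] using h.symm

theorem gSigma_of_mem {p : ℚ} {v : V} (hv : v ∈ S.gr p) :
    S.gSigma g v = ((-1 : ℂ) ^ parity p) • g v := by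
  simp [gSigma, S.sigma_of_mem hv]

theorem IsAutomorphism.gSigma_mem_gr (hg : S.IsAutomorphism g) {p : ℚ} {v : V}
    (hv : v ∈ S.gr p) : S.gSigma g v ∈ S.gr p := by
  rw [gSigma_of_mem hv]
  exact Submodule.smul_mem _ _ (hg.map_mem_gr hv)

theorem IsAutomorphism.gSigma_pow_of_mem_gr (hg : S.IsAutomorphism g) {p : ℚ} {v : V}
    (hv : v ∈ S.gr p) (j : ℕ) :
    (S.gSigma g ^ j) v = ((-1 : ℂ) ^ parity p) ^ j • (g ^ j) v ∧ (g ^ j) v ∈ S.gr p := by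
  induction j with
  | zero => simpa
  | succ j ih =>
    refine ⟨?_, by rw [pow_succ']; exact hg.map_mem_gr ih.2⟩
    rw [pow_succ', Module.End.mul_apply, ih.1, map_smul, gSigma_of_mem ih.2, smul_smul, pow_succ,
      pow_succ']
    rfl

/-- On each `V_p` the operator `gσ` is `±g`, so twice the order of `g` is an exponent that also
removes the sign. -/
theorem IsAutomorphism.ordGS_pos (hg : S.IsAutomorphism g) (hfin : IsOfFinOrder g) :
    0 < S.ordGS g := by
  rw [ordGS, orderOf_pos_iff, isOfFinOrder_iff_pow_eq_one]
  refine ⟨orderOf g * 2, by have := hfin.orderOf_pos; omega, ?_⟩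
  ext v
  refine S.gr_induction (P := fun v => (S.gSigma g ^ (orderOf g * 2)) v = (1 : Module.End ℂ V) v) v
    (fun p u hu => ?_) (by simp) (fun u v hu hv => by rw [map_add, map_add, hu, hv])
  rw [(hg.gSigma_pow_of_mem_gr hu _).1, pow_mul g, pow_orderOf_eq_one, ← pow_mul,
    show parity p * (orderOf g * 2) = 2 * (parity p * orderOf g) by ring, pow_mul]
  simp

-- Each `V_p` is stable under `gσ`, which has finite order, so it is spanned by eigenvectors of
-- `gσ`. Scalars are absorbed into these, so additivity of the property suffices.
@[elab_as_elim]
theorem IsAutomorphism.gr_eigGS_induction (hg : S.IsAutomorphism g) (hfin : IsOfFinOrder g)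
    {P : V → Prop} (v : V)
    (hom : ∀ p, ∀ s < S.ordGS g, ∀ u ∈ S.gr p, u ∈ S.eigGS g s → P u) (zero : P 0)
    (add : ∀ u v, P u → P v → P (u + v)) : P v := by
  refine S.gr_induction v (fun p u hu => ?_) zero add
  have := mem_span_eigenvectors (hg.ordGS_pos hfin) (pow_orderOf_eq_one (S.gSigma g))
    (fun v hv => hg.gSigma_mem_gr hv) hu
  clear hu
  induction this using Submodule.closure_induction with
  | zero => exact zero
  | add x y _ _ hx hy => exact add x y hx hy
  | smul_mem c x hx =>
    obtain ⟨hxp, r, hr, hxr⟩ := hx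
    exact hom p r hr _ (Submodule.smul_mem _ _ hxp) (Submodule.smul_mem _ _ hxr)

theorem IsAutomorphism.one_mem_eigGS (hg : S.IsAutomorphism g) : S.one ∈ S.eigGS g 0 := by
  rw [eigGS, Module.End.mem_eigenspace_iff, gSigma_of_mem S.one_mem, hg.map_one,
    parity, if_pos ⟨0, by simp⟩]
  simp

/-- A homogeneous vector of `V^{s*}` lies in some `V^r`, where `r / T₀` is congruent to
`wt u + s / T` modulo the integers. -/
theorem exists_mem_eigG (hfin : IsOfFinOrder g) {p : ℚ} {s : ℕ} {u : V} (hu0 : u ≠ 0)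
    (hu : u ∈ S.gr p) (hus : u ∈ S.eigGS g s) :
    ∃ r < ordG g, u ∈ eigG g r ∧
      ∃ k : ℤ, p - 1 + (s : ℚ) / (S.ordGS g : ℚ) = (r : ℚ) / (ordG g : ℚ) + k := by
  obtain ⟨m, hm⟩ : ∃ k : ℕ, p = (k : ℚ) / 2 := by
    by_contra h
    rw [S.gr_eq_bot p h] at hu
    exact hu0 hu
  set c : ℂ := Complex.exp (2 * Real.pi * Complex.I * (p + (s : ℂ) / (S.ordGS g : ℂ))) with hc
  -- Weights lie in `½ℤ`, so the sign of `σ` is `e^{2πip}` and `g` acts on `u` by `c = e^{2πi(p +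
  -- s/T)}`.
  have hsign : ((-1 : ℂ) ^ parity p) = Complex.exp (2 * Real.pi * Complex.I * p) := by
    have h1 : Complex.exp (2 * Real.pi * Complex.I * p) = (-1) ^ m := by
      rw [← Complex.exp_pi_mul_I, ← Complex.exp_nat_mul, hm]
      congr 1
      push_cast
      ring
    rw [h1, parity]
    split_ifs with h
    · obtain ⟨k, hk⟩ := h
      have : (m : ℤ) = 2 * k := by
        have : (m : ℚ) = 2 * k := by linarith
        exact_mod_cast this
      have : Even m := by
        rw [← Int.even_coe_nat]; exact ⟨k, by omega⟩
      simp [this.neg_one_pow]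
    · have : Odd m := by
        rw [← Nat.not_even_iff_odd]
        rintro ⟨k, rfl⟩
        exact h ⟨k, by rw [hm]; push_cast; ring⟩
      simp [this.neg_one_pow]
  have hgu : g u = c • u := by
    have h := Module.End.mem_eigenspace_iff.1 hus
    rw [gSigma_of_mem hu] at h
    have h2 : ((-1 : ℂ) ^ parity p) * ((-1 : ℂ) ^ parity p) = 1 := by
      rw [← mul_pow]; simp
    calc g u = ((-1 : ℂ) ^ parity p) • ((-1 : ℂ) ^ parity p) • g u := by
          rw [smul_smul, h2, one_smul]
      _ = c • u := by
          rw [h, smul_smul, hsign, ← Complex.exp_add, hc]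
          congr 2
          ring
  have hpow : ∀ j : ℕ, (g ^ j) u = c ^ j • u := by
    intro j
    induction j with
    | zero => simp
    | succ j ih =>
      rw [pow_succ', LinearEquiv.mul_apply, ih, map_smul, hgu, smul_smul, pow_succ]
  have hc1 : c ^ ordG g = 1 := by
    have h := hpow (ordG g)
    rw [ordG, pow_orderOf_eq_one] at h
    have h' : ((c ^ orderOf g) - 1) • u = 0 := by rw [sub_smul, ← h]; simp
    exact sub_eq_zero.1 ((smul_eq_zero.1 h').resolve_right hu0)
  have hT : ordG g ≠ 0 := hfin.orderOf_pos.ne'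
  have : NeZero (ordG g) := ⟨hT⟩
  obtain ⟨r, hr, hrc⟩ := (Complex.isPrimitiveRoot_exp (ordG g) hT).eq_pow_of_pow_eq_one hc1
  rw [← exp_mul_natCast_div] at hrc
  refine ⟨r, hr, ?_, ?_⟩
  · rw [eigG, Module.End.mem_eigenspace_iff, hrc]
    exact hgu
  · rw [hc, eq_comm, Complex.exp_eq_exp_iff_exists_int] at hrc
    obtain ⟨k, hk⟩ := hrc
    refine ⟨k - 1, ?_⟩
    have h2 : (2 * Real.pi * Complex.I : ℂ) ≠ 0 := Complex.two_pi_I_ne_zero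
    have h3 : (p : ℂ) + (s : ℂ) / (S.ordGS g : ℂ) = (r : ℂ) / (ordG g : ℂ) + k := by
      refine mul_left_cancel₀ h2 (hk.trans ?_)
      ring
    have h4 : p + (s : ℚ) / (S.ordGS g : ℚ) = (r : ℚ) / (ordG g : ℚ) + k := by
      have h5 : ((p + (s : ℚ) / (S.ordGS g : ℚ) : ℚ) : ℂ) = ((r : ℚ) / (ordG g : ℚ) + k : ℚ) := by
        push_cast
        exact h3
      exact Rat.cast_injective h5
    push_cast
    linarith

end VertexOperatorSuperalgebra
open VertexOperatorSuperalgebra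

/-! ### Twisted modes sorted by the eigenvalues of `gσ`. -/

namespace WeakTwistedModule

variable {V : Type*} [AddCommGroup V] [Module ℂ V] {S : VertexOperatorSuperalgebra V}
  {g : V ≃ₗ[ℂ] V} {M : Type*} [AddCommGroup M] [Module ℂ M] (A : WeakTwistedModule S g M)

/-- For `u ∈ V^{s*}`, only the modes `u_m` of degree in `-s / T + ℤ` are nonzero. -/
theorem Y_eq_zero_of_mem_eigGS (hfin : IsOfFinOrder g) {p : ℚ} {s : ℕ} {u : V} (hu : u ∈ S.gr p)
    (hus : u ∈ S.eigGS g s) {m : ℚ}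
    (hm : ¬ ∃ k : ℤ, m = p - 1 + (s : ℚ) / (S.ordGS g : ℚ) + k) : A.Y u m = 0 := by
  by_cases hu0 : u = 0
  · simp [hu0]
  obtain ⟨r, hr, hur, k, hk⟩ := exists_mem_eigG hfin hu0 hu hus
  refine A.exponents r hr u hur m fun ⟨j, hj⟩ => hm ⟨j - k, ?_⟩
  push_cast
  linarith

/-- The Jacobi identity for a homogeneous vector of `V^{s*}`. -/
theorem jacobi_of_mem_eigGS (hfin : IsOfFinOrder g) {p q : ℚ} {s : ℕ} {u v : V} (hu : u ∈ S.gr p)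
    (hus : u ∈ S.eigGS g s) (hv : v ∈ S.gr q) (w : M) (l : ℤ) {m : ℚ} (n : ℚ)
    (hm : ∃ k : ℤ, m = p - 1 + (s : ℚ) / (S.ordGS g : ℚ) + k) :
    (∑ᶠ i : ℕ, ((-1) ^ i * gbinom l i) • A.Y u (l + m - i) (A.Y v (n + i) w)) -
        ((-1) ^ (parity p * parity q) * (-1) ^ l : ℂ) •
          (∑ᶠ i : ℕ, ((-1) ^ i * gbinom l i) • A.Y v (l + n - i) (A.Y u (m + i) w)) =
      ∑ᶠ i : ℕ, gbinom m i • A.Y (S.Y u (l + i) v) (m + n - i) w := by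
  by_cases hu0 : u = 0
  · simp [hu0]
  obtain ⟨r, hr, hur, k, hk⟩ := exists_mem_eigG hfin hu0 hu hus
  obtain ⟨j, hj⟩ := hm
  exact A.jacobi r hr p q u v w hur hu hv l m n ⟨k + j, by push_cast; linarith⟩

/-! ### The submodule generated by a subspace. -/

/-- The linear span of all `v_m w` with `w ∈ W`. -/
def modeSpan (W : Submodule ℂ M) : Submodule ℂ M :=
  Submodule.span ℂ {x | ∃ (v : V) (m : ℚ), ∃ w ∈ W, x = A.Y v m w}

variable {A} {W : Submodule ℂ M}

theorem Y_mem_modeSpan (v : V) (m : ℚ) {w : M} (hw : w ∈ W) : A.Y v m w ∈ A.modeSpan W :=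
  Submodule.subset_span ⟨v, m, w, hw, rfl⟩

theorem le_modeSpan : W ≤ A.modeSpan W := fun w hw => by
  simpa [A.vacuum] using Y_mem_modeSpan (A := A) S.one (-1) hw

/-- In the Jacobi identity with `m` large, the terms `v u w` vanish. It then expresses `u_k v_n w`
through modes of iterates and terms `u v_{n+i} w` with `i > 0`, so downward induction on `n` from
the truncation bound applies. -/
theorem Y_Y_mem_modeSpan (hg : S.IsAutomorphism g) (hfin : IsOfFinOrder g) (u v : V) (k n : ℚ)
    {w : M} (hw : w ∈ W) : A.Y u k (A.Y v n w) ∈ A.modeSpan W := by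
  refine hg.gr_eigGS_induction hfin u (fun p s _ u hu hus => ?_) (by simp)
    (fun u u' h h' => by simpa using add_mem h h')
  refine S.gr_induction v (fun q v hv => ?_) (by simp)
    (fun u u' h h' => by simpa using add_mem h h')
  obtain ⟨N, hN⟩ := A.truncation v w
  obtain ⟨N', hN'⟩ := A.truncation u w
  -- `j` bounds how far `n` lies below the bound `N`; `k` stays universal since the recursion
  -- changes it.
  have main : ∀ j : ℕ, ∀ n : ℚ, N - j ≤ n → ∀ k : ℚ, A.Y u k (A.Y v n w) ∈ A.modeSpan W := by
    intro j
    induction j with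
    | zero => intro n hn k; simp [hN n (by simpa using hn)]
    | succ j ih =>
      intro n hn k
      by_cases hk : ∃ t : ℤ, k = p - 1 + (s : ℚ) / (S.ordGS g : ℚ) + t
      swap
      · simp [A.Y_eq_zero_of_mem_eigGS hfin hu hus hk]
      obtain ⟨t, ht⟩ := hk
      -- `t'` puts `m = p - 1 + s/T + t'` beyond the truncation bound for `u` on `w`; then `l = t -
      -- t'` gives `l + m = k`.
      obtain ⟨t', ht'⟩ := exists_int_gt (N' - (p - 1 + (s : ℚ) / (S.ordGS g : ℚ)))
      have hJ := A.jacobi_of_mem_eigGS hfin hu hus hv w (t - t') n ⟨t', rfl⟩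
      rw [finsum_eq_zero_of_forall_eq_zero (f := fun i : ℕ => ((-1) ^ i * gbinom (t - t' : ℤ) i) •
          A.Y v ((t - t' : ℤ) + n - i) (A.Y u _ w)), smul_zero, sub_zero] at hJ
      swap
      · intro i
        have hi : (0 : ℚ) ≤ i := Nat.cast_nonneg i
        rw [hN' _ (by linarith), map_zero, smul_zero]
      have hmem : (∑ᶠ i : ℕ, ((-1) ^ i * gbinom (t - t' : ℤ) i) •
          A.Y u ((t - t' : ℤ) + (p - 1 + (s : ℚ) / (S.ordGS g : ℚ) + t') - i)
            (A.Y v (n + i) w)) ∈ A.modeSpan W := by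
        rw [hJ]
        exact finsum_induction (· ∈ A.modeSpan W) (zero_mem _) (fun _ _ => add_mem)
          fun i => Submodule.smul_mem _ _ (Y_mem_modeSpan _ _ hw)
      -- Truncation of `v` on `w` makes the sum finite, so that the term `i = 0`, which is the
      -- target, can be split off.
      obtain ⟨B, hB⟩ := exists_nat_gt (N - n)
      rw [finsum_eq_sum_of_support_subset (s := Finset.range (B + 1)), Finset.sum_range_succ',
        Submodule.add_mem_iff_right] at hmem
      · convert hmem using 1
        rw [gbinom_zero_right, ht]
        push_cast
        simp only [pow_zero, mul_one, one_smul, sub_zero, add_zero]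
        congr 2
        ring_nf
      · refine Submodule.sum_mem _ fun i _ => Submodule.smul_mem _ _ (ih _ ?_ _)
        have hi : (0 : ℚ) ≤ i := Nat.cast_nonneg i
        push_cast at hn ⊢
        linarith
      · intro i hi
        by_contra hc
        have hc' : B ≤ i := by
          simp only [Finset.coe_range, Set.mem_Iio, not_lt] at hc
          omega
        have hc'' : (B : ℚ) ≤ i := by exact_mod_cast hc'
        exact hi (by simp [hN (n + i) (by linarith)])
  obtain ⟨j, hj⟩ := exists_nat_gt (N - n)
  exact main j n (by linarith) k

theorem Y_mem_modeSpan_of_mem (hg : S.IsAutomorphism g) (hfin : IsOfFinOrder g) (u : V) (k : ℚ)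
    {x : M} (hx : x ∈ A.modeSpan W) : A.Y u k x ∈ A.modeSpan W := by
  induction hx using Submodule.span_induction with
  | mem x hx =>
    obtain ⟨v, n, w, hw, rfl⟩ := hx
    exact Y_Y_mem_modeSpan hg hfin u v k n hw
  | zero => simp
  | add x y _ _ hx hy => simpa using add_mem hx hy
  | smul c x _ hx => simpa using Submodule.smul_mem _ c hx

theorem modeSpan_le (hg : S.IsAutomorphism g) (hfin : IsOfFinOrder g) {N : Submodule ℂ M}
    (h : ∀ p, ∀ s < S.ordGS g, ∀ v ∈ S.gr p, v ∈ S.eigGS g s → ∀ m, ∀ w ∈ W, A.Y v m w ∈ N) :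
    A.modeSpan W ≤ N := by
  refine Submodule.span_le.2 ?_
  rintro _ ⟨v, m, w, hw, rfl⟩
  exact hg.gr_eigGS_induction hfin (P := fun v => A.Y v m w ∈ N) v
    (fun p s hs v hv hvs => h p s hs v hv hvs m w hw) (by simp)
    (fun u v hu hv => by simpa using add_mem hu hv)

/-! ### Zero modes on lowest weight vectors. -/

variable (A)

/-- The linear map `o` with `o(v) = v_{wt v - 1}` for homogeneous `v`. -/
def zeroMode : V →ₗ[ℂ] Module.End ℂ M :=
  (DirectSum.toModule ℂ ℚ (Module.End ℂ M) fun p =>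
    LinearMap.proj (p - 1) ∘ₗ A.Y ∘ₗ (S.gr p).subtype) ∘ₗ S.components.toLinearMap

theorem zeroMode_of_mem {p : ℚ} {v : V} (hv : v ∈ S.gr p) : A.zeroMode v = A.Y v (p - 1) := by
  simp [zeroMode, S.components_of_mem hv]

theorem zeroMode_one : A.zeroMode S.one = 1 := by
  rw [A.zeroMode_of_mem S.one_mem, A.vacuum, if_pos (by norm_num)]

/-- Modes of `u` have degree in `-s/T + ℤ`, which omits `0` when `0 < s < T`. This matches `*_g`
vanishing on such `u`. -/
theorem zeroMode_eq_zero (hfin : IsOfFinOrder g) {p : ℚ} {s : ℕ} {u : V} (hs : 0 < s)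
    (hsT : s < S.ordGS g) (hu : u ∈ S.gr p) (hus : u ∈ S.eigGS g s) : A.zeroMode u = 0 := by
  rw [A.zeroMode_of_mem hu]
  refine A.Y_eq_zero_of_mem_eigGS hfin hu hus fun ⟨k, hk⟩ => ?_
  have h0 : (0 : ℚ) < S.ordGS g := by exact_mod_cast hs.trans hsT
  have h1 : (0 : ℚ) < (s : ℚ) / S.ordGS g := div_pos (by exact_mod_cast hs) h0
  have h2 : (s : ℚ) / S.ordGS g < 1 := (div_lt_one h0).2 (by exact_mod_cast hsT)
  have h3 : (-k : ℤ) = (s : ℚ) / S.ordGS g := by push_cast; linarith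
  rw [← h3] at h1 h2
  norm_cast at h1 h2
  omega

/-- The zero mode of `Res_z (1 + z)^a z^k Y(u, z) v` as a sum of modes of iterates. -/
theorem zeroMode_res {p q : ℚ} {u v : V} (hu : u ∈ S.gr p) (hv : v ∈ S.gr q) (a : ℚ) (k : ℤ)
    (w : M) : A.zeroMode (S.res a k u v) w =
      ∑ᶠ i : ℕ, gbinom a i • A.Y (S.Y u (k + i) v) (p + q - k - 2 - i) w := by
  have h := AddMonoidHom.map_finsum (((LinearMap.applyₗ w) ∘ₗ A.zeroMode : V →ₗ[ℂ] M).toAddMonoidHom)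
    (S.finite_support_res a k u v)
  refine h.trans (finsum_congr fun i => ?_)
  have hm := S.Y_mem_gr hu hv (k + i)
  simp only [LinearMap.toAddMonoidHom_coe, map_smul, LinearMap.comp_apply,
    LinearMap.applyₗ_apply_apply, A.zeroMode_of_mem hm]
  congr 4
  push_cast
  ring_nf

variable {A}

/-- A homogeneous mode of negative degree annihilates `Ω(M)`. -/
theorem Y_Omega {p : ℚ} {u : V} (hu : u ∈ S.gr p) {m : ℚ} (hm : p - 1 < m) {w : M}
    (hw : w ∈ A.Omega) : A.Y u m w = 0 := by
  simpa using hw p u hu (m - (p - 1)) (by linarith)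

/-- The zero mode of `u ∘_g v` is the iterate side of a Jacobi identity in which both products on
the other side end in a mode of negative degree acting on `w`. -/
theorem zeroMode_circ (hfin : IsOfFinOrder g) {p : ℚ} {r : ℕ} {u : V} (v : V)
    (hr : r < S.ordGS g) (hu : u ∈ S.gr p) (hur : u ∈ S.eigGS g r) {w : M} (hw : w ∈ A.Omega) :
    A.zeroMode (S.circ g p r u v) w = 0 := by
  refine S.gr_induction v (fun q v hv => ?_) (by simp [circ])
    (fun v v' h h' => by simp only [circ, map_add, LinearMap.add_apply] at h h' ⊢; simp [h, h'])
  rw [circ, A.zeroMode_res hu hv]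
  set d : ℤ := if r = 0 then 1 else 0 with hd
  have hd' : (if r = 0 then 1 else 0 : ℚ) = d := by rw [hd]; split_ifs <;> simp
  have h0 : (0 : ℚ) < S.ordGS g := by exact_mod_cast (Nat.zero_le r).trans_lt hr
  have hpos : 0 < (d : ℚ) + (r : ℚ) / S.ordGS g := by
    by_cases h : r = 0
    · simp [hd, h]
    · simpa [hd, h] using div_pos (by exact_mod_cast Nat.pos_of_ne_zero h) h0
  have hpos' : (r : ℚ) / S.ordGS g < 1 := (div_lt_one h0).2 (by exact_mod_cast hr)
  -- `l` and `m` are the exponents of `z` and `1 + z` in `∘_g`, and `n` makes the total degree zero.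
  -- Here `m > wt u - 1` because `δ_r + r/T > 0`, and `n > wt v - 1` because `r/T < 1`.
  have hJ := A.jacobi_of_mem_eigGS hfin hu hur hv w (-1 - d)
    (m := p - 1 + d + (r : ℚ) / S.ordGS g) (q - (r : ℚ) / S.ordGS g) ⟨d, by ring⟩
  rw [finsum_eq_zero_of_forall_eq_zero, finsum_eq_zero_of_forall_eq_zero, smul_zero, sub_zero] at hJ
  · rw [hd']
    refine Eq.trans (finsum_congr fun i => ?_) hJ.symm
    congr 3
    push_cast
    ring_nf
  · intro i
    have hi : (0 : ℚ) ≤ i := Nat.cast_nonneg i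
    rw [Y_Omega hu (by linarith) hw, map_zero, smul_zero]
  · intro i
    have hi : (0 : ℚ) ≤ i := Nat.cast_nonneg i
    rw [Y_Omega hv (by linarith) hw, map_zero, smul_zero]

theorem zeroMode_star (hg : S.IsAutomorphism g) (hfin : IsOfFinOrder g) (u v : V) {w : M}
    (hw : w ∈ A.Omega) :
    A.zeroMode (S.star g u v) w = A.zeroMode u (A.zeroMode v w) := by
  refine hg.gr_eigGS_induction hfin u (fun p s hs u hu hus => ?_) (by simp)
    (fun u u' h h' => by simp [h, h'])
  rcases Nat.eq_zero_or_pos s with rfl | hs0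
  swap
  · rw [S.star_of_mem_pos g hs0 hs hus, A.zeroMode_eq_zero hfin hs0 hs hu hus]
    simp
  refine S.gr_induction v (fun q v hv => ?_) (by simp) (fun v v' h h' => by simp [h, h'])
  rw [S.star_of_mem_zero g (hg.ordGS_pos hfin) hu hus, A.zeroMode_res hu hv,
    A.zeroMode_of_mem hu, A.zeroMode_of_mem hv]
  -- Now `n = wt v - 1` has degree exactly zero, so the term `i = 0` of the first sum survives: it
  -- is `o(u) o(v) w`.
  have hJ := A.jacobi_of_mem_eigGS hfin hu hus hv w (-1) (m := p) (q - 1) ⟨1, by simp⟩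
  rw [finsum_eq_single _ 0, finsum_eq_zero_of_forall_eq_zero, smul_zero, sub_zero] at hJ
  · refine (Eq.trans (finsum_congr fun i => ?_) hJ.symm).trans ?_
    · congr 3
      push_cast
      ring_nf
    · simp only [gbinom_zero_right]
      push_cast
      simp [neg_add_eq_sub]
  · intro i
    have hi : (0 : ℚ) ≤ i := Nat.cast_nonneg i
    rw [Y_Omega hu (by linarith) hw, map_zero, smul_zero]
  · intro i hi
    have hi : (0 : ℚ) < i := by exact_mod_cast Nat.pos_of_ne_zero hi
    rw [Y_Omega hv (by linarith) hw, map_zero, smul_zero]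

theorem zeroMode_eq_zero_of_mem_Og (hfin : IsOfFinOrder g) {x : V} (hx : x ∈ S.Og g) {w : M}
    (hw : w ∈ A.Omega) : A.zeroMode x w = 0 := by
  have hle : S.Og g ≤ LinearMap.ker (LinearMap.applyₗ w ∘ₗ A.zeroMode : V →ₗ[ℂ] M) := by
    refine Submodule.span_le.2 ?_
    rintro _ ⟨p, r, u, v, hr, hu, hur, rfl⟩
    exact zeroMode_circ hfin v hr hu hur hw
  exact hle hx

end WeakTwistedModule

/-! ### Degree arguments in simple admissible modules. -/

namespace AdmissibleTwistedModule

variable {V : Type*} [AddCommGroup V] [Module ℂ V] {S : VertexOperatorSuperalgebra V}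
  {g : V ≃ₗ[ℂ] V} {M : Type*} [AddCommGroup M] [Module ℂ M] {A : AdmissibleTwistedModule S g M}

theorem gr_eq_bot_of_neg {n : ℚ} (hn : n < 0) : A.gr n = ⊥ :=
  A.gr_eq_bot n fun ⟨k, hk⟩ => hn.not_ge (hk ▸ by positivity)

/-- A graded subspace generates a graded submodule. -/
theorem modeSpan_eq_iSup (hg : S.IsAutomorphism g) (hfin : IsOfFinOrder g) {W : Submodule ℂ M}
    {d : ℚ} (hW : W ≤ A.gr d) :
    A.modeSpan W = ⨆ n : ℚ, A.modeSpan W ⊓ A.gr n := by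
  refine le_antisymm ?_ (iSup_le fun n => inf_le_left)
  refine WeakTwistedModule.modeSpan_le hg hfin fun p s _ v hv _ m w hw => ?_
  exact Submodule.mem_iSup_of_mem _
    ⟨WeakTwistedModule.Y_mem_modeSpan v m hw, A.map_gr p v hv m d w (hW hw)⟩

/-- In a simple module, a nonzero homogeneous subspace generates everything. -/
theorem IsSimple.modeSpan_eq_top (hA : A.IsSimple) (hg : S.IsAutomorphism g)
    (hfin : IsOfFinOrder g) {W : Submodule ℂ M} {d : ℚ} (hW : W ≤ A.gr d) (hW0 : W ≠ ⊥) :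
    A.modeSpan W = ⊤ :=
  (hA.2 _ (fun v m _ hw => WeakTwistedModule.Y_mem_modeSpan_of_mem hg hfin v m hw)
    (modeSpan_eq_iSup hg hfin hW)).resolve_left
    fun h => hW0 (le_bot_iff.1 (h ▸ WeakTwistedModule.le_modeSpan))

theorem gr_zero_le_Omega : A.gr 0 ≤ A.Omega := fun w hw p u hu n hn => by
  have h := A.map_gr p u hu (p - 1 + n) 0 w hw
  rw [gr_eq_bot_of_neg (by linarith)] at h
  simpa using h

/-- A homogeneous subspace `W` whose generated submodule is everything contains `M(0)` as soon as
the degree-zero part of that submodule lies in `W`. -/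
theorem gr_zero_le_of_modeSpan_eq_top (hg : S.IsAutomorphism g) (hfin : IsOfFinOrder g)
    {W U : Submodule ℂ M} {d : ℚ} (hW : W ≤ A.gr d) (hU : U ≤ A.gr 0) (htop : A.modeSpan W = ⊤)
    (h : ∀ p, ∀ s < S.ordGS g, ∀ v ∈ S.gr p, v ∈ S.eigGS g s → ∀ w ∈ W,
      A.Y v (d + p - 1) w ∈ U) : A.gr 0 ≤ U := by
  intro x hx
  refine mem_of_mem_sup_iSup_ne A.isInternal.submodule_iSupIndep hU hx ?_
  have hx' : x ∈ A.modeSpan W := by rw [htop]; trivial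
  refine WeakTwistedModule.modeSpan_le hg hfin (fun p s hs v hv hvs m w hw => ?_) hx'
  -- This is the degree of `v_m w`: one value of `m` lands in `M(0)`, and all others land in the
  -- remaining summands.
  by_cases hm : d + p - m - 1 = 0
  · rw [show m = d + p - 1 by linarith]
    exact Submodule.mem_sup_left (h p s hs v hv hvs w hw)
  · exact Submodule.mem_sup_right
      (Submodule.mem_iSup_of_mem _ (Submodule.mem_iSup_of_mem hm (A.map_gr p v hv m d w (hW hw))))

/-- For `d > 0`, a mode carrying `M(d)` to `M(0)` has negative degree and so kills `Ω(M)`. A nonzero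
intersection would generate `M` with zero degree-zero part. -/
theorem IsSimple.Omega_inf_gr (hA : A.IsSimple) (hg : S.IsAutomorphism g) (hfin : IsOfFinOrder g)
    (h0 : A.gr 0 ≠ ⊥) {d : ℚ} (hd : d ≠ 0) : A.Omega ⊓ A.gr d = ⊥ := by
  rcases lt_or_gt_of_ne hd with hd | hd
  · rw [gr_eq_bot_of_neg hd, inf_bot_eq]
  by_contra hne
  have hle : A.Omega ⊓ A.gr d ≤ A.gr d := inf_le_right
  refine h0 (le_bot_iff.1 (gr_zero_le_of_modeSpan_eq_top hg hfin hle bot_le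
    (hA.modeSpan_eq_top hg hfin hle hne) fun p s _ v hv _ w hw => ?_))
  rw [WeakTwistedModule.Y_Omega hv (by linarith) hw.1]
  exact zero_mem _

/-- Homogeneous modes commute with the projections to the `M(k)` up to a shift of `k`, so `Ω(M)`
contains the components of its vectors, and `Omega_inf_gr` removes those of nonzero degree. -/
theorem IsSimple.Omega_eq (hA : A.IsSimple) (hg : S.IsAutomorphism g) (hfin : IsOfFinOrder g)
    (h0 : A.gr 0 ≠ ⊥) : A.Omega = A.gr 0 := by
  refine le_antisymm (fun w hw => ?_) gr_zero_le_Omega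
  let D := A.isInternal.chooseDecomposition
  have hcomp : ∀ (p : ℚ) (u : V), u ∈ S.gr p → ∀ (m k : ℚ) (x : M),
      A.Y u m (DirectSum.decompose A.gr x k) =
        DirectSum.decompose A.gr (A.Y u m x) (k + p - m - 1) := by
    intro p u hu m k x
    induction x using DirectSum.Decomposition.inductionOn A.gr with
    | zero => simp
    | @homogeneous i x =>
      have hx := A.map_gr p u hu m i x x.2
      by_cases hik : i = k
      · subst hik
        rw [DirectSum.decompose_of_mem_same _ x.2, DirectSum.decompose_of_mem_same _ hx]
      · rw [DirectSum.decompose_of_mem_ne _ x.2 hik, map_zero, DirectSum.decompose_of_mem_ne _ hx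
          (fun h => hik (by linarith))]
    | add x y hx hy => simp [DirectSum.decompose_add, hx, hy]
  have hzero : ∀ k : ℚ, k ≠ 0 → (DirectSum.decompose A.gr w k : M) = 0 := by
    intro k hk
    have hmem : (DirectSum.decompose A.gr w k : M) ∈ A.Omega ⊓ A.gr k := by
      refine ⟨fun p u hu n hn => ?_, (DirectSum.decompose A.gr w k).2⟩
      rw [hcomp p u hu, hw p u hu n hn]
      simp
    rwa [hA.Omega_inf_gr hg hfin h0 hk, Submodule.mem_bot] at hmem
  classical
  rw [← DirectSum.sum_support_decompose A.gr w]
  refine Submodule.sum_mem _ fun k _ => ?_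
  by_cases hk : k = 0
  · subst hk; exact (DirectSum.decompose A.gr w 0).2
  · rw [hzero k hk]; exact zero_mem _

theorem zeroMode_mem_gr_zero (v : V) {w : M} (hw : w ∈ A.gr 0) : A.zeroMode v w ∈ A.gr 0 := by
  refine S.gr_induction v (fun p v hv => ?_) (by simp)
    (fun u v hu hv => by simpa using add_mem hu hv)
  rw [A.zeroMode_of_mem hv]
  simpa using A.map_gr p v hv (p - 1) 0 w hw

/-- The action of `A_g(V)` on `Ω(M)` by zero modes, when `Ω(M) = M(0)`. -/
def omegaModule (A : AdmissibleTwistedModule S g M) (hg : S.IsAutomorphism g)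
    (hfin : IsOfFinOrder g) (hO : A.Omega = A.gr 0) : S.AgModule g A.Omega :=
  have hmem : ∀ (v : V), ∀ w ∈ A.Omega, A.zeroMode v w ∈ A.Omega := fun v w hw => by
    rw [hO] at hw ⊢
    exact zeroMode_mem_gr_zero v hw
  { act := (S.Og g).liftQ
      { toFun := fun v => (A.zeroMode v).restrict (hmem v)
        map_add' := fun u v => by ext w; simp
        map_smul' := fun c v => by ext w; simp }
      (fun x hx => by
        refine LinearMap.ext fun w => Subtype.ext ?_
        exact WeakTwistedModule.zeroMode_eq_zero_of_mem_Og hfin hx w.2)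
    act_star := fun a b => by
      refine LinearMap.ext fun w => Subtype.ext ?_
      exact WeakTwistedModule.zeroMode_star hg hfin a b w.2
    act_one := by
      refine LinearMap.ext fun w => Subtype.ext ?_
      exact LinearMap.congr_fun A.zeroMode_one (w : M) }

theorem omegaModule_act (hg : S.IsAutomorphism g) (hfin : IsOfFinOrder g) (hO : A.Omega = A.gr 0)
    (a : V) (w : A.Omega) :
    ((A.omegaModule hg hfin hO).act ((S.Og g).mkQ a) w : M) = A.zeroMode a w := rfl

/-- A nonzero submodule of `M(0)` generates `M`, and the degree-zero part of what it generates comes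
from zero modes alone, which preserve it. -/
theorem IsSimple.omegaModule_isSimple (hA : A.IsSimple) (hg : S.IsAutomorphism g)
    (hfin : IsOfFinOrder g) (hO : A.Omega = A.gr 0) (h0 : A.gr 0 ≠ ⊥) :
    (A.omegaModule hg hfin hO).IsSimple := by
  refine ⟨(Submodule.nontrivial_iff_ne_bot).2 (hO ▸ h0), fun N hN => ?_⟩
  rw [or_iff_not_imp_left]
  intro hN0
  set U : Submodule ℂ M := N.map A.Omega.subtype with hU
  have hU0 : U ≠ ⊥ := fun h => hN0 (by
    rwa [hU, ← Submodule.map_bot A.Omega.subtype,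
      (Submodule.map_injective_of_injective A.Omega.injective_subtype).eq_iff] at h)
  have hUle : U ≤ A.gr 0 := hO ▸ Submodule.map_subtype_le _ _
  have hle : A.gr 0 ≤ U := by
    refine gr_zero_le_of_modeSpan_eq_top hg hfin hUle hUle (hA.modeSpan_eq_top hg hfin hUle hU0) ?_
    rintro p s - v hv - _ ⟨w, hw, rfl⟩
    rw [zero_add, ← A.zeroMode_of_mem hv]
    exact ⟨_, hN ((S.Og g).mkQ v) w hw, rfl⟩
  refine eq_top_iff.2 fun w _ => ?_
  obtain ⟨w', hw', h⟩ := hle (hO.le w.2)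
  rwa [← show w' = w from Subtype.ext h]

end AdmissibleTwistedModule
end VOSA
end

theorem proposition5p2 {V : Type*} [AddCommGroup V] [Module ℂ V]
    (S : VOSA.VertexOperatorSuperalgebra V) (g : V ≃ₗ[ℂ] V) (hg : S.IsAutomorphism g)
    (hfin : IsOfFinOrder g) {M : Type*} [AddCommGroup M] [Module ℂ M]
    (A : VOSA.AdmissibleTwistedModule S g M) (hA : A.IsSimple) (h0 : A.gr 0 ≠ ⊥) :
    A.Omega = A.gr 0 ∧
      ∃ R : S.AgModule g A.Omega,
        (∀ (p : ℚ) (a : V), a ∈ S.gr p → a ∈ S.eigGS g 0 → ∀ w : A.Omega,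
          (R.act ((S.Og g).mkQ a) w : M) = A.Y a (p - 1) w) ∧
        R.IsSimple := by
  have hO := hA.Omega_eq hg hfin h0
  refine ⟨hO, A.omegaModule hg hfin hO, fun p a ha _ w => ?_,
    hA.omegaModule_isSimple hg hfin hO h0⟩
  rw [VOSA.AdmissibleTwistedModule.omegaModule_act, A.zeroMode_of_mem ha]
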